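/- A \emph{loop} is a set $L$ with a binary operation $\cdot$, an element $1$ with $1\cdot y=y\cdot 1=y$ for all $y$, and left and right divisions $\backslash,/$ satisfying $x\cdot(x\backslash y)=x\backslash(x\cdot y)=(y/x)\cdot x=(y\cdot x)/x=y$ for all $x,y\in L$. For $x\in L$ let $L(x)$ and $R(x)$ be the permutations of $L$, acting on the right, given by $yL(x)=xy$ and $yR(x)=yx$. An \emph{ARIF loop} is a loop that is flexible, i.e. $x(yx)=(xy)x$ for all $x,y$ (so that $xyx$ is unambiguous), and satisfies, for all $x,y\in L$, $$R(x)R(yxy)=R(xyx)R(y)\qquad\text{and}\qquad L(x)L(yxy)=L(xyx)L(y),$$ where products of permutations are composed from left to right; that is, $(zx)(yxy)=(z(xyx))y$ and $(yxy)(xz)=y((xyx)z)$ for all $x,y,z\in L$. \textbf{Theorem.} Every ARIF loop $L$ is \emph{diassociative}: for all $x,y\in L$, the subloop of $L$ generated by $x$ and $y$ (the smallest subset containing $x,y,1$ and closed under $\cdot$, $\backslash$ and $/$) is a group. -/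

import Mathlib

universe u

/-- A loop `(L; ·, \, /, 1)`: a set with a multiplication, left and right divisions
and a two-sided identity element. -/
class Loop (L : Type u) extends MulOneClass L where
  /-- `ldiv x y` is the left quotient `x \ y`. -/
  ldiv : L → L → L
  /-- `rdiv y x` is the right quotient `y / x`. -/
  rdiv : L → L → L
  mul_ldiv : ∀ x y : L, x * ldiv x y = y
  ldiv_mul : ∀ x y : L, ldiv x (x * y) = y
  rdiv_mul : ∀ x y : L, rdiv y x * x = y
  mul_rdiv : ∀ x y : L, rdiv (y * x) x = y

namespace Loop

/-- The left translation `y ↦ x * y`. -/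
def leftTrans {L : Type u} [Loop L] (x : L) : Equiv.Perm L where
  toFun y := x * y
  invFun y := ldiv x y
  left_inv y := ldiv_mul x y
  right_inv y := mul_ldiv x y

/-- The right translation `y ↦ y * x`. -/
def rightTrans {L : Type u} [Loop L] (x : L) : Equiv.Perm L where
  toFun y := y * x
  invFun y := rdiv y x
  left_inv y := mul_rdiv x y
  right_inv y := rdiv_mul x y

/-- The flexible law. -/
def IsFlexible (L : Type u) [Loop L] : Prop :=
  ∀ x y : L, x * (y * x) = (x * y) * x

/-- ARIF loops. Permutations act on the right, so a product of translations applies its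
left factor first; this is `Equiv.trans`. -/
structure IsARIF (L : Type u) [Loop L] : Prop where
  flexible : IsFlexible L
  w1 : ∀ x y : L, (rightTrans x).trans (rightTrans ((y * x) * y)) =
    (rightTrans ((x * y) * x)).trans (rightTrans y)
  w2 : ∀ x y : L, (leftTrans x).trans (leftTrans ((y * x) * y)) =
    (leftTrans ((x * y) * x)).trans (leftTrans y)

/-- A loop is a group if its multiplication and identity are those of some group structure
on the same set. -/
def IsGroup (L : Type u) [inst : Loop L] : Prop :=
  ∃ G : Group L, G.toDivInvMonoid.toMonoid.toMulOneClass = inst.toMulOneClass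

end Loop

/-- A subloop: a subset containing `1` and closed under multiplication and both divisions. -/
structure Subloop (L : Type u) [Loop L] where
  carrier : Set L
  one_mem : 1 ∈ carrier
  mul_mem : ∀ {a b : L}, a ∈ carrier → b ∈ carrier → a * b ∈ carrier
  ldiv_mem : ∀ {a b : L}, a ∈ carrier → b ∈ carrier → Loop.ldiv a b ∈ carrier
  rdiv_mem : ∀ {a b : L}, a ∈ carrier → b ∈ carrier → Loop.rdiv a b ∈ carrier

namespace Subloop

/-- A subloop is a loop under the restricted operations. -/
instance instLoop {L : Type u} [Loop L] (H : Subloop L) : Loop H.carrier where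
  mul a b := ⟨a.1 * b.1, H.mul_mem a.2 b.2⟩
  one := ⟨1, H.one_mem⟩
  one_mul a := Subtype.ext (one_mul a.1)
  mul_one a := Subtype.ext (mul_one a.1)
  ldiv a b := ⟨Loop.ldiv a.1 b.1, H.ldiv_mem a.2 b.2⟩
  rdiv a b := ⟨Loop.rdiv a.1 b.1, H.rdiv_mem a.2 b.2⟩
  mul_ldiv a b := Subtype.ext (Loop.mul_ldiv a.1 b.1)
  ldiv_mul a b := Subtype.ext (Loop.ldiv_mul a.1 b.1)
  rdiv_mul a b := Subtype.ext (Loop.rdiv_mul a.1 b.1)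
  mul_rdiv a b := Subtype.ext (Loop.mul_rdiv a.1 b.1)

/-- The subloop generated by a set: the intersection of all subloops containing it. -/
def closure {L : Type u} [Loop L] (S : Set L) : Subloop L where
  carrier := {a | ∀ H : Subloop L, S ⊆ H.carrier → a ∈ H.carrier}
  one_mem H _ := H.one_mem
  mul_mem ha hb H hH := H.mul_mem (ha H hH) (hb H hH)
  ldiv_mem ha hb H hH := H.ldiv_mem (ha H hH) (hb H hH)
  rdiv_mem ha hb H hH := H.rdiv_mem (ha H hH) (hb H hH)

end Subloop

/-- A loop is diassociative if the subloop generated by any two elements is a group. -/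
def Loop.IsDiassociative (L : Type u) [Loop L] : Prop :=
  ∀ x y : L, Loop.IsGroup (Subloop.closure ({x, y} : Set L)).carrier

/-!
The sequences `X k = x ^ k * b` satisfy `X (k + 1) * (X k)⁻¹ * X (k + 1) = X (k + 2)`. By the ARIF
identity for the pair `(X (k + 1))⁻¹`, `X (k + 2)`, the permutation
`rightTrans (X (k + 2)) * (rightTrans (X k))⁻¹` does not depend on `k`, so a coincidence
`z * X i = w * X j` propagates when both indices are shifted by the same even number. Consequently
all powers of `x` associate with `a` and `b` as soon as they cancel between `a` and `b` and a single
odd power associates.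

Diassociativity follows by induction on the number of letters of alternating words in powers of `x`
and `y`. To associate the powers of `y` between two words, one moves the splitting point to the last
letter and then back to the first one. Since a single odd power suffices at each position, the
letters passed on the way back may be taken to have exponent `1`, and what remains is to associate
`y` between `x ^ a` and a word `x * (y * (x * ⋯))` whose exponents but the last are all `1`. This
word is `(x * y) ^ j * b` for a power `b` of `x` or `y`, hence belongs to a progression. Words of
four letters are too short to move the splitting point and are treated by the parity of an exponent.
-/

namespace Loop

section Inverse

variable {L : Type*} [Loop L]

instance : IsCancelMul L where
  mul_left_cancel x _ _ h := (leftTrans x).injective h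
  mul_right_cancel x _ _ h := (rightTrans x).injective h

/-- The right inverse `x \ 1`; it is also a left inverse under `HasInverseProperty`. -/
instance : Inv L := ⟨fun x => ldiv x 1⟩

protected theorem mul_inv_cancel (x : L) : x * x⁻¹ = 1 := mul_ldiv x 1

theorem isGroup_of_mul_assoc (h : ∀ x y z : L, x * y * z = x * (y * z)) : IsGroup L :=
  ⟨Group.ofRightAxioms h mul_one Loop.mul_inv_cancel, rfl⟩

@[simp]
theorem leftTrans_apply (x y : L) : leftTrans x y = x * y := rfl

@[simp]
theorem rightTrans_apply (x y : L) : rightTrans x y = y * x := rfl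

@[simp]
theorem rightTrans_one : rightTrans (1 : L) = 1 := Equiv.ext mul_one

/-- Integer powers, as iterated right translations of `1`. -/
instance : Pow L ℤ := ⟨fun x n => (rightTrans x ^ n) 1⟩

theorem zpow_eq_rightTrans_zpow_one (x : L) (n : ℤ) : x ^ n = (rightTrans x ^ n) 1 := rfl

@[simp]
protected theorem zpow_zero (x : L) : x ^ (0 : ℤ) = 1 := rfl

@[simp]
protected theorem zpow_one (x : L) : x ^ (1 : ℤ) = x := by
  simp [zpow_eq_rightTrans_zpow_one]

/-- The inverse property: translations by `x⁻¹` are inverse to translations by `x`. -/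
class HasInverseProperty (L : Type*) [Loop L] : Prop where
  inv_mul_cancel_left (x y : L) : x⁻¹ * (x * y) = y
  mul_inv_cancel_right (x y : L) : x * y * y⁻¹ = x

variable [HasInverseProperty L]

@[simp]
protected theorem inv_mul_cancel_left (x y : L) : x⁻¹ * (x * y) = y :=
  HasInverseProperty.inv_mul_cancel_left x y

@[simp]
protected theorem mul_inv_cancel_right (x y : L) : x * y * y⁻¹ = x :=
  HasInverseProperty.mul_inv_cancel_right x y

protected theorem inv_mul_cancel (x : L) : x⁻¹ * x = 1 := by
  simpa using Loop.inv_mul_cancel_left x 1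

instance : InvolutiveInv L where
  inv_inv x := by simpa [Loop.inv_mul_cancel] using Loop.inv_mul_cancel_left x⁻¹ x

@[simp]
protected theorem mul_inv_cancel_left (x y : L) : x * (x⁻¹ * y) = y := by
  simpa using Loop.inv_mul_cancel_left x⁻¹ y

@[simp]
protected theorem inv_mul_cancel_right (x y : L) : x * y⁻¹ * y = x := by
  simpa using Loop.mul_inv_cancel_right x y⁻¹

instance : InvOneClass L where
  inv_one := by simpa using Loop.mul_inv_cancel (1 : L)

@[simp]
protected theorem mul_inv_rev (x y : L) : (x * y)⁻¹ = y⁻¹ * x⁻¹ := by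
  have h : (x * y)⁻¹ * x = y⁻¹ := by
    simpa using Loop.inv_mul_cancel_left (x * y) y⁻¹
  rw [← h, Loop.mul_inv_cancel_right]

theorem ldiv_eq_inv_mul (x y : L) : ldiv x y = x⁻¹ * y := by
  rw [← Loop.inv_mul_cancel_left x (ldiv x y), mul_ldiv]

theorem rdiv_eq_mul_inv (x y : L) : rdiv x y = x * y⁻¹ := by
  rw [← Loop.mul_inv_cancel_right (rdiv x y) y, rdiv_mul]

theorem rightTrans_inv (x : L) : rightTrans x⁻¹ = (rightTrans x)⁻¹ :=
  eq_inv_of_mul_eq_one_left (Equiv.ext fun y => by simp)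

@[simp]
protected theorem zpow_neg_one (x : L) : x ^ (-1 : ℤ) = x⁻¹ := by
  simp [zpow_eq_rightTrans_zpow_one, ← rightTrans_inv]

theorem leftTrans_eq_conj (x : L) :
    leftTrans x = Equiv.inv L * (rightTrans x)⁻¹ * (Equiv.inv L)⁻¹ := by
  rw [← rightTrans_inv]
  ext y
  simp [Equiv.Perm.inv_def]

end Inverse

section ARIF

variable {L : Type*} [Loop L] [hL : Fact (IsARIF L)]

theorem flexible (x y : L) : x * (y * x) = x * y * x := hL.out.flexible x y

theorem commute_leftTrans_rightTrans (x : L) : Commute (leftTrans x) (rightTrans x) :=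
  Equiv.ext fun y => flexible x y

theorem rightTrans_sandwich (x y : L) :
    rightTrans (y * x * y) * rightTrans x = rightTrans y * rightTrans (x * y * x) :=
  hL.out.w1 x y

theorem leftTrans_sandwich (x y : L) :
    leftTrans (y * x * y) * leftTrans x = leftTrans y * leftTrans (x * y * x) :=
  hL.out.w2 x y

theorem one_rdiv_mul_mul (x y : L) : rdiv 1 x * (x * y) = y := by
  have h := Equiv.congr_fun (rightTrans_sandwich x (rdiv y x)) (rdiv 1 x)
  simp only [Equiv.Perm.mul_apply, rightTrans_apply, rdiv_mul, one_mul,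
    ← flexible x (rdiv y x)] at h
  exact (mul_right_cancel h).symm

instance : HasInverseProperty L where
  inv_mul_cancel_left x y := by
    have h : x⁻¹ = rdiv 1 x := by
      simpa [Loop.mul_inv_cancel] using (one_rdiv_mul_mul x x⁻¹).symm
    rw [h, one_rdiv_mul_mul]
  mul_inv_cancel_right y x := by
    have h := Equiv.congr_fun (leftTrans_sandwich x (ldiv x y)) x⁻¹
    simp only [Equiv.Perm.mul_apply, leftTrans_apply, Loop.mul_inv_cancel, mul_one, mul_ldiv,
      ← flexible (ldiv x y) x] at h
    exact (mul_left_cancel h).symm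

/-! ### Progressions -/

/-- The sequences satisfying the recursion of `k ↦ x ^ k * b`, which in a group are exactly the
two-sided geometric progressions. -/
def IsProgression (X : ℤ → L) : Prop :=
  ∀ k, X (k + 1) * (X k)⁻¹ * X (k + 1) = X (k + 2)

theorem exists_zpow_mul_of_ratio_eq {G : Type*} [Group G] {D : ℤ → G}
    (hD : ∀ k, D (k + 3) * (D (k + 1))⁻¹ = D (k + 2) * (D k)⁻¹) :
    ∃ c : G, ∀ k n : ℤ, D (k + 2 * n) = c ^ n * D k := by
  have ratio_periodic : Function.Periodic (fun k => D (k + 2) * (D k)⁻¹) 1 := fun k => by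
    simpa only [add_assoc, one_add_one_eq_two, show (1 : ℤ) + 2 = 3 from rfl] using hD k
  obtain ⟨c, two_step⟩ : ∃ c : G, ∀ k, D (k + 2) = c * D k := by
    refine ⟨D 2 * (D 0)⁻¹, fun k => eq_mul_of_mul_inv_eq ?_⟩
    simpa using ratio_periodic.int_mul_eq k
  refine ⟨c, fun k n => ?_⟩
  have rescaled_periodic : Function.Periodic (fun n : ℤ => (c ^ n)⁻¹ * D (k + 2 * n)) 1 :=
    fun n => by
      dsimp only
      rw [mul_add_one, ← add_assoc, two_step, add_comm n 1, zpow_one_add]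
      group
  simpa [inv_mul_eq_iff_eq_mul] using rescaled_periodic.int_mul_eq n

namespace IsProgression

variable {X Y : ℤ → L}

theorem backward (hX : IsProgression X) (k : ℤ) :
    X (k + 1) * (X (k + 2))⁻¹ * X (k + 1) = X k := by
  simp [← hX k]

theorem inv (hX : IsProgression X) : IsProgression fun k => (X k)⁻¹ := fun k => by
  simp [← hX k, flexible]

theorem ext (hX : IsProgression X) (hY : IsProgression Y) (h₀ : X 0 = Y 0) (h₁ : X 1 = Y 1) :
    X = Y := by
  suffices h : ∀ k, X k = Y k ∧ X (k + 1) = Y (k + 1) from funext fun k => (h k).1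
  intro k
  induction k using Int.induction_on with
  | zero => exact ⟨h₀, h₁⟩
  | succ k ih => exact ⟨ih.2, by rw [add_assoc, one_add_one_eq_two, ← hX, ← hY, ih.1, ih.2]⟩
  | pred k ih =>
    obtain ⟨l, hl⟩ : ∃ l : ℤ, -(k : ℤ) = l + 1 := ⟨-k - 1, by ring⟩
    rw [hl, add_assoc, one_add_one_eq_two] at ih
    rw [hl, add_sub_cancel_right]
    exact ⟨by rw [← hX.backward, ← hY.backward, ih.1, ih.2], ih.1⟩

theorem rightTrans_ratio (hX : IsProgression X) (k : ℤ) :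
    rightTrans (X (k + 3)) * (rightTrans (X (k + 1)))⁻¹ =
      rightTrans (X (k + 2)) * (rightTrans (X k))⁻¹ := by
  have next : X (k + 2) * (X (k + 1))⁻¹ * X (k + 2) = X (k + 3) := by
    simpa only [add_assoc, one_add_one_eq_two, show (1 : ℤ) + 2 = 3 from rfl] using hX (k + 1)
  have prev : (X (k + 1))⁻¹ * X (k + 2) * (X (k + 1))⁻¹ = (X k)⁻¹ := by
    simpa using hX.inv.backward k
  simpa only [next, prev, rightTrans_inv] using rightTrans_sandwich (X (k + 1))⁻¹ (X (k + 2))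

theorem exists_rightTrans_eq_zpow_mul (hX : IsProgression X) :
    ∃ c : Equiv.Perm L, ∀ k n : ℤ, rightTrans (X (k + 2 * n)) = c ^ n * rightTrans (X k) :=
  exists_zpow_mul_of_ratio_eq (D := fun k => rightTrans (X k)) hX.rightTrans_ratio

theorem mul_shift_congr (hX : IsProgression X) {z w : L} {i j : ℤ} (h : z * X i = w * X j)
    (n : ℤ) : z * X (i + 2 * n) = w * X (j + 2 * n) := by
  obtain ⟨c, hc⟩ := hX.exists_rightTrans_eq_zpow_mul
  simp only [← rightTrans_apply, hc, Equiv.Perm.mul_apply] at h ⊢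
  rw [h]

theorem mul_shift_eq (hX : IsProgression X) {z w : L} {i n : ℤ} (h : z * X (i + 2 * n) = w * X i)
    (j : ℤ) : z * X (j + 2 * n) = w * X j := by
  obtain ⟨c, hc⟩ := hX.inv.exists_rightTrans_eq_zpow_mul
  have shift (k : ℤ) : z * X (k + 2 * n) = (c ^ n)⁻¹ z * X k := by
    have h := hc k n
    rw [rightTrans_inv, rightTrans_inv, inv_eq_iff_eq_inv, _root_.mul_inv_rev, inv_inv] at h
    exact Equiv.congr_fun h z
  rw [shift] at h ⊢
  rw [mul_right_cancel h]

theorem mul_eq_mul_of_diag (hX : IsProgression X) {f : ℤ → L}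
    (diag : ∀ i, f i * X (-i) = f 0 * X 0) (i j n : ℤ) :
    f i * X j = f (i + 2 * n) * X (j - 2 * n) := by
  have base : f i * X (-i - 2 * n + 2 * n) = f (i + 2 * n) * X (-i - 2 * n) := by
    rw [sub_add_cancel, diag, ← diag (i + 2 * n), neg_add']
  simpa using hX.mul_shift_eq base (j - 2 * n)

theorem mul_eq_of_odd (hX : IsProgression X) {f : ℤ → L}
    (diag : ∀ i, f i * X (-i) = f 0 * X 0) {d : ℤ} (hd : Odd d) (edge : f d * X 0 = f 0 * X d)
    (i j : ℤ) : f i * X j = f 0 * X (i + j) := by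
  have row_d (j : ℤ) : f d * X j = f 0 * X (d + j) := by
    rcases Int.even_or_odd j with ⟨m, rfl⟩ | hj
    · simpa [two_mul] using hX.mul_shift_congr (i := 0) (j := d) edge m
    · obtain ⟨m, hm⟩ := hd.add_odd hj
      have := hX.mul_shift_congr (diag d) m
      rwa [show -d + 2 * m = j by lia, show 0 + 2 * m = d + j by lia] at this
  rcases Int.even_or_odd i with ⟨m, hm⟩ | hi
  · rw [hX.mul_eq_mul_of_diag diag i j (-m), show i + 2 * -m = 0 by lia]
    congr 2
    lia
  · obtain ⟨m, hm⟩ := hd.sub_odd hi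
    rw [hX.mul_eq_mul_of_diag diag i j m, show i + 2 * m = d by lia, row_d]
    congr 2
    lia

end IsProgression

/-! ### Powers -/

theorem self_mul_zpow (x : L) (n : ℤ) : x * x ^ n = x ^ (n + 1) :=
  calc
    x * x ^ n = (leftTrans x * rightTrans x ^ n) 1 := rfl
    _ = (rightTrans x ^ n * leftTrans x) 1 := by
      rw [((commute_leftTrans_rightTrans x).zpow_right n).eq]
    _ = x ^ (n + 1) := by
      simp [zpow_eq_rightTrans_zpow_one, zpow_add_one]

theorem isProgression_zpow (x : L) : IsProgression fun n : ℤ => x ^ n := fun n => by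
  dsimp only
  rw [← self_mul_zpow x n, Loop.mul_inv_cancel_right, self_mul_zpow, self_mul_zpow, add_assoc,
    one_add_one_eq_two]

theorem rightTrans_zpow (x : L) (n : ℤ) : rightTrans (x ^ n) = rightTrans x ^ n := by
  obtain ⟨c, hc⟩ := (isProgression_zpow x).exists_rightTrans_eq_zpow_mul
  have c_eq : c = rightTrans x * rightTrans x := by
    simpa [rightTrans_inv, eq_mul_inv_iff_mul_eq, eq_comm] using hc (-1) 1
  rw [← zpow_two] at c_eq
  rcases Int.even_or_odd' n with ⟨m, rfl | rfl⟩
  · simpa [c_eq, zpow_mul] using hc 0 m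
  · have odd_power := hc 1 m
    rwa [Loop.zpow_one, c_eq, ← zpow_mul, ← zpow_add_one, add_comm] at odd_power

theorem mul_zpow_eq_rightTrans_zpow (z x : L) (n : ℤ) : z * x ^ n = (rightTrans x ^ n) z := by
  rw [← rightTrans_zpow, rightTrans_apply]

@[simp]
protected theorem inv_zpow (x : L) (n : ℤ) : (x ^ n)⁻¹ = x ^ (-n) := by
  rw [← one_mul (x ^ n)⁻¹, ← rightTrans_apply, rightTrans_inv, rightTrans_zpow, ← zpow_neg,
    zpow_eq_rightTrans_zpow_one]

theorem leftTrans_zpow (x : L) (n : ℤ) : leftTrans (x ^ n) = leftTrans x ^ n := by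
  rw [leftTrans_eq_conj, leftTrans_eq_conj, rightTrans_zpow, conj_zpow, inv_zpow]

@[simp]
theorem mul_zpow_mul_zpow (z x : L) (m n : ℤ) : z * x ^ m * x ^ n = z * x ^ (m + n) := by
  simp only [mul_zpow_eq_rightTrans_zpow]
  rw [add_comm, zpow_add, Equiv.Perm.mul_apply]

@[simp]
theorem zpow_mul_zpow (x : L) (m n : ℤ) : x ^ m * x ^ n = x ^ (m + n) := by
  simpa using mul_zpow_mul_zpow 1 x m n

@[simp]
theorem zpow_mul_zpow_mul (x z : L) (m n : ℤ) : x ^ m * (x ^ n * z) = x ^ (m + n) * z := by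
  apply inv_injective
  simp [add_comm]

theorem mul_self_mul_zpow (z x : L) (n : ℤ) : z * x * x ^ n = z * x ^ (1 + n) := by
  simpa using mul_zpow_mul_zpow z x 1 n

theorem mul_zpow_mul_self (z x : L) (n : ℤ) : z * x ^ n * x = z * x ^ (n + 1) := by
  simpa using mul_zpow_mul_zpow z x n 1

theorem zpow_mul_self_mul (x z : L) (n : ℤ) : x ^ n * (x * z) = x ^ (n + 1) * z := by
  simpa using zpow_mul_zpow_mul x z n 1

theorem self_mul_zpow_mul (x z : L) (n : ℤ) : x * (x ^ n * z) = x ^ (1 + n) * z := by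
  simpa using zpow_mul_zpow_mul x z 1 n

theorem zpow_flexible (x z : L) (m n : ℤ) : x ^ m * (z * x ^ n) = x ^ m * z * x ^ n := by
  have h := ((commute_leftTrans_rightTrans x).zpow_zpow m n).eq
  rw [← leftTrans_zpow, ← rightTrans_zpow] at h
  exact Equiv.congr_fun h z

theorem isProgression_zpow_mul (x b : L) : IsProgression fun k : ℤ => x ^ k * b := fun k => by
  have ratio : x ^ (k + 1) * b * (x ^ k * b)⁻¹ = x := by
    rw [add_comm, ← self_mul_zpow_mul, Loop.mul_inv_cancel_right]
  dsimp only
  rw [ratio, self_mul_zpow_mul, ← add_assoc, add_comm 1 k, add_assoc, one_add_one_eq_two]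

theorem isProgression_mul_zpow (a x : L) : IsProgression fun k : ℤ => a * x ^ k := fun k => by
  have ratio : (a * x ^ k)⁻¹ * (a * x ^ (k + 1)) = x := by
    rw [← mul_zpow_mul_self, Loop.inv_mul_cancel_left]
  dsimp only
  rw [← flexible, ratio, mul_zpow_mul_self, add_assoc, one_add_one_eq_two]

theorem inv_mul_zpow_mul (c x : L) (k : ℤ) : c⁻¹ * (x ^ k * c) = (c⁻¹ * (x * c)) ^ k := by
  have eq_progression : (fun k : ℤ => x ^ k * c) = fun k => c * (c⁻¹ * (x * c)) ^ k :=
    (isProgression_zpow_mul x c).ext (isProgression_mul_zpow c _) (by simp) (by simp)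
  rw [congrFun eq_progression k, Loop.inv_mul_cancel_left]

end ARIF

section AlternatingProducts

variable {L : Type*} [Loop L]

/-- The powers of `x` associate with `a` on their left and `b` on their right. -/
def AssocAlong (a x b : L) : Prop :=
  ∀ i j : ℤ, a * x ^ i * (x ^ j * b) = a * (x ^ (i + j) * b)

theorem AssocAlong.assoc {a b x : L} (h : AssocAlong a x b) (i : ℤ) :
    a * x ^ i * b = a * (x ^ i * b) := by
  simpa using h i 0

/-- The alternating product `x ^ e₁ * (y ^ e₂ * (x ^ e₃ * ⋯))`. -/
def altProd (x y : L) : List ℤ → L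
  | [] => 1
  | e :: l => x ^ e * altProd y x l

@[simp]
theorem altProd_nil (x y : L) : altProd x y [] = 1 := rfl

@[simp]
theorem altProd_cons (x y : L) (e : ℤ) (l : List ℤ) :
    altProd x y (e :: l) = x ^ e * altProd y x l := rfl

/-- The value `r⁻¹ x ^ i s`, where `r` and `s` are alternating products starting with a power
of `y`. -/
def link (x y : L) (r : List ℤ) (i : ℤ) (s : List ℤ) : L :=
  (altProd y x r)⁻¹ * (x ^ i * altProd y x s)

/-- Links compose as in a group as long as the three words involved have total length less
than `n`. -/
def LinksCompose (L : Type*) [Loop L] (n : ℕ) : Prop :=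
  ∀ (x y : L) (r s t : List ℤ) (i j : ℤ), r.length + s.length + t.length < n →
    link x y r i s * link x y s j t = link x y r (i + j) t

theorem LinksCompose.assocAlong {n : ℕ} (h : LinksCompose L n) (x y : L) {r t : List ℤ}
    (hn : r.length + t.length < n) : AssocAlong (altProd y x r)⁻¹ x (altProd y x t) :=
  fun i j => by simpa [link] using h x y r [] t i j (by grind)

variable [Fact (IsARIF L)]

namespace AssocAlong

variable {a b x : L}

theorem symm (h : AssocAlong a x b) : AssocAlong b⁻¹ x a⁻¹ := fun i j => by
  apply inv_injective
  simpa [add_comm, h.assoc] using h (-j) (-i)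

theorem of_odd (diag : ∀ i : ℤ, a * x ^ i * (x ^ (-i) * b) = a * b) {d : ℤ} (hd : Odd d)
    (assoc_d : a * x ^ d * b = a * (x ^ d * b)) : AssocAlong a x b := fun i j => by
  simpa using (isProgression_zpow_mul x b).mul_eq_of_odd (f := fun i => a * x ^ i)
    (by simpa using diag) hd (by simpa using assoc_d) i j

end AssocAlong

theorem assocAlong_zpow_zpow (x y : L) (m n : ℤ) : AssocAlong (y ^ m) x (y ^ n) := by
  refine .of_odd (fun p => ?_) odd_one (zpow_flexible y _ m n).symm
  have h : x ^ (-p) * y ^ n = (y ^ m * x ^ p)⁻¹ * (y ^ m * y ^ n) := by simp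
  rw [h, Loop.mul_inv_cancel_left]

namespace LinksCompose

variable {n : ℕ}

theorem inv_link (h : LinksCompose L n) (x y : L) {r s : List ℤ} (i : ℤ)
    (hn : r.length + s.length < n) : (link x y r i s)⁻¹ = link x y s (-i) r := by
  simpa [link] using (h.assocAlong x y (r := s) (t := r) (by lia)).assoc (-i)

theorem link_cons_left (h : LinksCompose L n) (x y : L) (a : ℤ) {r s : List ℤ} (i : ℤ)
    (hn : r.length + s.length + 1 < n) : link x y (a :: r) i s = link y x r (-a) (i :: s) := by
  have hn' : r.length + (i :: s).length < n := by simpa only [List.length_cons, add_assoc] using hn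
  simpa [link] using (h.assocAlong y x hn').assoc (-a)

theorem link_cons_zero_cons (h : LinksCompose L n) (x y : L) (a b : ℤ) {r s : List ℤ}
    (hn : r.length + s.length < n) :
    link x y (a :: r) 0 (b :: s) = link y x r (-a + b) s := by
  simpa [link] using h.assocAlong y x hn (-a) b

theorem link_zero_mul_link (h : LinksCompose L n) (x y : L) {r s : List ℤ} (hr : r ≠ [])
    (hs : s ≠ []) (t : List ℤ) (j : ℤ) (hn : r.length + s.length + t.length ≤ n) :
    link x y r 0 s * link x y s j t = link x y r j t := by
  obtain ⟨a, r, rfl⟩ := List.exists_cons_of_ne_nil hr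
  obtain ⟨b, s, rfl⟩ := List.exists_cons_of_ne_nil hs
  simp only [List.length_cons] at hn
  rw [h.link_cons_zero_cons x y a b (by lia), h.link_cons_left x y b j (by lia),
    h.link_cons_left x y a j (by lia),
    h y x r s (j :: t) _ _ (by grind), add_neg_cancel_right]

theorem link_mul_link_zero (h : LinksCompose L n) (x y : L) {r s t : List ℤ} (hr : r ≠ [])
    (hs : s ≠ []) (ht : t ≠ []) (i : ℤ) (hn : r.length + s.length + t.length ≤ n) :
    link x y r i s * link x y s 0 t = link x y r i t := by
  have := List.length_pos_iff.2 hr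
  have := List.length_pos_iff.2 hs
  have := List.length_pos_iff.2 ht
  apply inv_injective
  rw [Loop.mul_inv_rev, h.inv_link x y _ (by lia), h.inv_link x y _ (by lia),
    h.inv_link x y _ (by lia), neg_zero, h.link_zero_mul_link x y ht hs _ _ (by lia)]

theorem isProgression_link (h : LinksCompose L n) (x y : L) {s t : List ℤ} (hs : s ≠ [])
    (ht : t ≠ []) (hn : 2 * s.length + t.length ≤ n) :
    IsProgression fun k => link x y s k t := by
  have eq_zpow_mul :
      (fun k => link x y s k t) = fun k : ℤ => link x y s 1 s ^ k * link x y s 0 t := by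
    funext k
    rw [← h.link_mul_link_zero x y hs hs ht k (by lia)]
    simp only [link, Loop.zpow_one, inv_mul_zpow_mul]
  rw [eq_zpow_mul]
  exact isProgression_zpow_mul _ _

theorem link_mul_link_of_length_le (h : LinksCompose L n) (x y : L) {r s t : List ℤ}
    (hr : r ≠ []) (hs : s ≠ []) (ht : t ≠ []) (hsr : s.length ≤ r.length)
    (hn : r.length + s.length + t.length ≤ n) (i j : ℤ) :
    link x y r i s * link x y s j t = link x y r (i + j) t := by
  have := List.length_pos_iff.2 hr
  have := List.length_pos_iff.2 ht
  have diag (i : ℤ) : link x y r i s * link x y s (-i) t = link x y r 0 t := by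
    rw [← h.link_zero_mul_link x y hr ht s i (by lia), ← h.inv_link x y i (by lia),
      Loop.mul_inv_cancel_right]
  have edge (j : ℤ) : link x y r 0 s * link x y s j t = link x y r j t :=
    h.link_zero_mul_link x y hr hs t j hn
  rw [← edge]
  refine (h.isProgression_link x y hs ht (by lia)).mul_eq_of_odd (f := fun i => link x y r i s)
    (fun i => by rw [diag, edge]) odd_one ?_ i j
  rw [edge, h.link_mul_link_zero x y hr hs ht 1 hn]

theorem link_mul_link_of_ne_nil (h : LinksCompose L n) (x y : L) {r s t : List ℤ} (hr : r ≠ [])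
    (hs : s ≠ []) (ht : t ≠ []) (hn : r.length + s.length + t.length ≤ n) (i j : ℤ) :
    link x y r i s * link x y s j t = link x y r (i + j) t := by
  have := List.length_pos_iff.2 ht
  rcases le_total s.length r.length with hsr | hrs
  · exact h.link_mul_link_of_length_le x y hr hs ht hsr hn i j
  · have swapped := h.link_mul_link_of_length_le x y hs hr ht hrs (by lia) (-i) (i + j)
    rw [← h.inv_link x y i (by lia), neg_add_cancel_left] at swapped
    rw [← swapped, Loop.mul_inv_cancel_left]

theorem assocAlong_of_odd (h : LinksCompose L n) (x y : L) {r t : List ℤ} (hr : r ≠ [])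
    (ht : t ≠ []) (hn : r.length + t.length = n) {d : ℤ} (hd : Odd d)
    (assoc_d : (altProd y x r)⁻¹ * x ^ d * altProd y x t =
      (altProd y x r)⁻¹ * (x ^ d * altProd y x t)) :
    AssocAlong (altProd y x r)⁻¹ x (altProd y x t) := by
  refine .of_odd (fun p => ?_) hd assoc_d
  obtain ⟨a, r, rfl⟩ := List.exists_cons_of_ne_nil hr
  obtain ⟨b, t, rfl⟩ := List.exists_cons_of_ne_nil ht
  simp only [List.length_cons] at hn
  have compose := h y x r [p] t (-a) b (by grind)
  have left := (h.assocAlong y x (r := r) (t := [p]) (by grind)).assoc (-a)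
  have outer := h.assocAlong y x (r := r) (t := t) (by lia) (-a) b
  simp only [link, altProd_cons, altProd_nil, mul_one, Loop.inv_zpow, Loop.mul_inv_rev]
    at compose left outer ⊢
  rw [left, compose, outer]

theorem succ (h : LinksCompose L n)
    (assocAlong_eq : ∀ (x y : L) (r t : List ℤ), r ≠ [] → t ≠ [] → r.length + t.length = n →
      AssocAlong (altProd y x r)⁻¹ x (altProd y x t)) :
    LinksCompose L (n + 1) := by
  have assocAlong_le (x y : L) (r t : List ℤ) (hn : r.length + t.length ≤ n) :
      AssocAlong (altProd y x r)⁻¹ x (altProd y x t) := by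
    rcases eq_or_ne r [] with rfl | hr
    · intro i j; simp
    rcases eq_or_ne t [] with rfl | ht
    · intro i j; simp
    rcases hn.lt_or_eq with hn | hn
    · exact h.assocAlong x y hn
    · exact assocAlong_eq x y r t hr ht hn
  intro x y r s t i j hn
  rcases eq_or_ne s [] with rfl | hs
  · simpa [link] using assocAlong_le x y r t (by grind) i j
  rcases eq_or_ne r [] with rfl | hr
  · have assoc_st := assocAlong_le x y s t (by grind) (-i) (i + j)
    have inv_eq : (altProd y x s)⁻¹ * x ^ (-i) = (x ^ i * altProd y x s)⁻¹ := by simp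
    rw [neg_add_cancel_left, inv_eq] at assoc_st
    simp only [link, altProd_nil, inv_one, one_mul]
    rw [← assoc_st, Loop.mul_inv_cancel_left]
  rcases eq_or_ne t [] with rfl | ht
  · have assoc_rs := assocAlong_le x y r s (by grind) (i + j) (-j)
    have inv_eq : (altProd y x s)⁻¹ * x ^ j = (x ^ (-j) * altProd y x s)⁻¹ := by simp
    rw [add_neg_cancel_right] at assoc_rs
    simp only [link, altProd_nil, mul_one]
    rw [← assoc_rs, inv_eq, Loop.mul_inv_cancel_right]
  exact h.link_mul_link_of_ne_nil x y hr hs ht (by lia) i j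

end LinksCompose

theorem linksCompose_three : LinksCompose L 3 := by
  have zero : LinksCompose L 0 := fun _ _ _ _ _ _ _ h => by lia
  refine ((zero.succ ?_).succ ?_).succ ?_ <;> intro x y r t hr ht hn <;>
    have := List.length_pos_iff.2 hr <;> have := List.length_pos_iff.2 ht
  · lia
  · lia
  · obtain ⟨a, rfl⟩ := List.length_eq_one_iff.1 (show r.length = 1 by lia)
    obtain ⟨b, rfl⟩ := List.length_eq_one_iff.1 (show t.length = 1 by lia)
    simpa using assocAlong_zpow_zpow x y (-a) b

/-! ### Moving the splitting point -/

theorem mul_mul_zpow_mul {a v b : L} (assoc_b : a * v * b = a * (v * b))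
    (cancel_b : a * v * (v⁻¹ * b) = a * b) (j : ℤ) :
    a * v * (v ^ j * b) = a * (v ^ (j + 1) * b) := by
  have shift {i i' : ℤ} (h : a * v * (v ^ i * b) = a * (v ^ i' * b)) (n : ℤ) :=
    (isProgression_zpow_mul v b).mul_shift_congr h n
  rcases Int.even_or_odd' j with ⟨m, rfl | rfl⟩
  · simpa [add_comm] using shift (i := 0) (i' := 1) (by simpa using assoc_b) m
  · have := shift (i := -1) (i' := 0) (by simpa using cancel_b) (m + 1)
    rwa [show -1 + 2 * (m + 1) = 2 * m + 1 by ring,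
      show 0 + 2 * (m + 1) = 2 * m + 1 + 1 by ring] at this

theorem mul_mul_of_mul_inv_mul_inv_mul {a g b : L}
    (h : a * g * (g⁻¹ * (g⁻¹ * b)) = a * (g⁻¹ * b)) : a * g * b = a * (g * b) := by
  have sq : g⁻¹ * (g⁻¹ * b) = g ^ (-2 : ℤ) * b := by
    simpa using zpow_mul_zpow_mul g b (-1) (-1)
  have := (isProgression_zpow_mul g b).mul_shift_congr (z := a * g) (w := a) (i := -2) (j := -1)
    (by rw [← sq, h, Loop.zpow_neg_one]) 1
  simpa using this

theorem mul_zpow_absorb_zpow_left (x y : L) (d k j : ℤ) :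
    x ^ k * (x * y) * ((x * y) ^ j * x ^ d) = x ^ k * ((x * y) ^ (j + 1) * x ^ d) := by
  refine mul_mul_zpow_mul (zpow_flexible x _ k d).symm ?_ j
  have inv_mul : (x * y)⁻¹ * x ^ d = (x ^ k * (x * y))⁻¹ * (x ^ k * x ^ d) := by
    have := mul_zpow_mul_zpow y⁻¹ x (-1) d
    rw [Loop.zpow_neg_one] at this
    simp only [zpow_mul_self_mul, Loop.mul_inv_rev, Loop.inv_zpow, zpow_mul_zpow,
      mul_zpow_mul_zpow, this]
    congr 2
    ring
  rw [inv_mul, Loop.mul_inv_cancel_left]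

theorem mul_zpow_absorb_zpow_right (x y : L) (d k j : ℤ) :
    x ^ k * (x * y) * ((x * y) ^ j * y ^ d) = x ^ k * ((x * y) ^ (j + 1) * y ^ d) := by
  refine mul_mul_zpow_mul ?_ ?_ j
  · simp only [zpow_mul_self_mul, mul_self_mul_zpow]
  have inv_mul : (x * y)⁻¹ * y ^ d = (x ^ k * (x * y))⁻¹ * (x ^ k * y ^ d) := by
    have h := assocAlong_zpow_zpow x y (-1) d (-(k + 1)) k
    rw [show -(k + 1) + k = -1 by ring, zpow_flexible] at h
    rw [zpow_mul_self_mul, Loop.mul_inv_rev, Loop.mul_inv_rev, Loop.inv_zpow]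
    simpa using h.symm
  rw [inv_mul, Loop.mul_inv_cancel_left]

theorem zpow_mul_mul_of_mul_zpow_absorb {x y b : L}
    (absorb : ∀ k j : ℤ,
      x ^ k * (x * y) * ((x * y) ^ j * b) = x ^ k * ((x * y) ^ (j + 1) * b)) (a : ℤ) :
    x ^ a * y * b = x ^ a * (y * b) := by
  have assoc_b (k : ℤ) : x ^ k * (x * y) * b = x ^ k * (x * y * b) := by simpa using absorb k 0
  calc
    x ^ a * y * b = x ^ (a - 1) * (x * y) * b := by rw [zpow_mul_self_mul, sub_add_cancel]
    _ = x ^ a * (x ^ (-1 : ℤ) * (x * y * b)) := by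
      rw [assoc_b, zpow_mul_zpow_mul, sub_eq_add_neg]
    _ = x ^ a * (y * b) := by rw [← assoc_b, Loop.zpow_neg_one, Loop.inv_mul_cancel_left]

namespace LinksCompose

variable {n : ℕ}

theorem mul_zpow_absorb_altProd_replicate (h : LinksCompose L n) (x y : L) (d : ℤ) :
    ∀ m : ℕ, m < n → ∀ k j : ℤ,
      x ^ k * (x * y) * ((x * y) ^ j * altProd x y (List.replicate m 1 ++ [d])) =
        x ^ k * ((x * y) ^ (j + 1) * altProd x y (List.replicate m 1 ++ [d]))
  | 0, _, k, j => by simpa using mul_zpow_absorb_zpow_left x y d k j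
  | 1, _, k, j => by
    have peel : altProd x y (List.replicate 1 1 ++ [d]) = x * y * y ^ (d - 1) := by
      simp [mul_self_mul_zpow]
    rw [peel, zpow_mul_self_mul (x * y), zpow_mul_self_mul (x * y), mul_zpow_absorb_zpow_right]
  | m + 2, hm, k, j => by
    have peel : altProd x y (List.replicate (m + 2) 1 ++ [d]) =
        x * y * altProd x y (List.replicate m 1 ++ [d]) := by
      have := (h.assocAlong y x (r := [-1]) (t := List.replicate m 1 ++ [d])
        (by grind)).assoc 1
      simpa [List.replicate_succ] using this.symm
    rw [peel, zpow_mul_self_mul (x * y), zpow_mul_self_mul (x * y),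
      h.mul_zpow_absorb_altProd_replicate x y d m (by lia)]

theorem zpow_mul_mul_altProd_replicate (h : LinksCompose L n) (x y : L) (a d : ℤ) {m : ℕ}
    (hm : m < n) :
    x ^ a * y * altProd x y (List.replicate m 1 ++ [d]) =
      x ^ a * (y * altProd x y (List.replicate m 1 ++ [d])) :=
  zpow_mul_mul_of_mul_zpow_absorb (h.mul_zpow_absorb_altProd_replicate x y d m hm) a

theorem mul_two_letters_mul_of_ne_nil (h : LinksCompose L n) (x y : L) (a b c d : ℤ) {r : List ℤ}
    (hr : r ≠ []) (t : List ℤ) (hn : r.length + t.length + 3 = n) :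
    (altProd x y (a :: r))⁻¹ * y ^ b * x ^ c * altProd y x (d :: t) =
      (altProd x y (a :: r))⁻¹ * (y ^ b * (x ^ c * altProd y x (d :: t))) := by
  have := List.length_pos_iff.2 hr
  have regroup_left : (altProd x y (a :: r))⁻¹ * y ^ b * x ^ c =
      (altProd x y (a :: r))⁻¹ * (y ^ b * x ^ c) := by
    simpa using (h.assocAlong y x (r := a :: r) (t := [c]) (by grind)).assoc b
  have regroup_right : y ^ b * (x ^ c * altProd y x (d :: t)) =
      y ^ b * x ^ c * altProd y x (d :: t) := by
    simpa using ((h.assocAlong x y (r := [-b]) (t := d :: t) (by grind)).assoc c).symm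
  -- Multiplying by the inverse of `y ^ b * x ^ c` does not lengthen the word `d :: t`, so the claim
  -- for the inverse pair involves only links known to compose.
  have inv_mul : (y ^ b * x ^ c)⁻¹ * altProd y x (d :: t) =
      x ^ (-c) * altProd y x ((-b + d) :: t) := by
    simpa using h.assocAlong y x (r := [c]) (t := t) (by grind) (-b) d
  have link_left : (altProd x y (a :: r))⁻¹ * (y ^ b * x ^ c) = link x y r (-a) [b, c] := by
    simpa [link] using (h.assocAlong x y (r := r) (t := [b, c]) (by grind)).assoc (-a)
  have link_outer : (altProd x y (a :: r))⁻¹ * (x ^ (-c) * altProd y x ((-b + d) :: t)) =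
      link x y r (-a + -c) ((-b + d) :: t) := by
    simpa [link] using h.assocAlong x y (r := r) (t := (-b + d) :: t) (by grind) (-a) (-c)
  have link_right : (y ^ b * x ^ c)⁻¹ * (x ^ (-c) * altProd y x ((-b + d) :: t)) =
      link x y [b, c] (-c) ((-b + d) :: t) := by
    simp [link]
  rw [regroup_left, regroup_right]
  apply mul_mul_of_mul_inv_mul_inv_mul
  rw [inv_mul, link_left, link_right, link_outer,
    h.link_mul_link_of_ne_nil x y hr (by simp) (by simp) (by grind)]

theorem mul_two_letters_mul (h : LinksCompose L n) (h4 : 4 ≤ n) (x y : L) (b c : ℤ)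
    {l t : List ℤ} (hl : l ≠ []) (ht : t ≠ []) (hn : l.length + t.length + 1 = n) :
    (altProd x y l)⁻¹ * y ^ b * x ^ c * altProd y x t =
      (altProd x y l)⁻¹ * (y ^ b * (x ^ c * altProd y x t)) := by
  obtain ⟨a, r, rfl⟩ := List.exists_cons_of_ne_nil hl
  obtain ⟨d, t, rfl⟩ := List.exists_cons_of_ne_nil ht
  simp only [List.length_cons] at hn
  rcases eq_or_ne r [] with rfl | hr
  · have ht : t ≠ [] := by
      rintro rfl
      simp only [List.length_nil] at hn
      lia
    have mirrored := h.mul_two_letters_mul_of_ne_nil y x d (-c) (-b) a ht [] (by grind)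
    apply inv_injective
    simpa using mirrored.symm
  · exact h.mul_two_letters_mul_of_ne_nil x y a b c d hr t (by lia)

theorem assocAlong_altProd_replicate (h : LinksCompose L n) (h4 : 4 ≤ n) :
    ∀ (l : List ℤ) (x y : L) (m : ℕ) (d : ℤ), l ≠ [] → l.length + m + 1 = n →
      AssocAlong (altProd x y l)⁻¹ y (altProd x y (List.replicate m 1 ++ [d]))
  | [], _, _, _, _, hl, _ => absurd rfl hl
  | [a], x, y, m, d, hl, hn => by
    simp only [List.length_singleton] at hn
    refine h.assocAlong_of_odd y x hl (by simp) (by grind) odd_one ?_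
    simpa using h.zpow_mul_mul_altProd_replicate x y (-a) d (m := m) (by lia)
  | c :: a :: l, x, y, m, d, hl, hn => by
    simp only [List.length_cons] at hn
    have ih := h.assocAlong_altProd_replicate h4 (a :: l) y x (m + 1) d (by simp) (by grind)
    have moved := h.mul_two_letters_mul h4 y x (-c) 1 (l := a :: l)
      (t := List.replicate m 1 ++ [d]) (by simp) (by simp) (by grind)
    refine h.assocAlong_of_odd y x hl (by simp) (by grind) odd_one ?_
    have split := ih.assoc (-c)
    rw [List.replicate_succ, List.cons_append, altProd_cons y x 1, ← moved] at split
    rw [altProd_cons x y c, Loop.mul_inv_rev, Loop.inv_zpow, split]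

theorem assocAlong_of_length_add_eq (h : LinksCompose L n) (h4 : 4 ≤ n) :
    ∀ (t l : List ℤ) (x y : L), t ≠ [] → l ≠ [] → l.length + t.length = n →
      AssocAlong (altProd x y l)⁻¹ y (altProd x y t)
  | [], _, _, _, ht, _, _ => absurd rfl ht
  | [d], l, x, y, _, hl, hn => by
    simpa using h.assocAlong_altProd_replicate h4 l x y 0 d hl (by grind)
  | d :: e :: t, l, x, y, ht, hl, hn => by
    simp only [List.length_cons] at hn
    have ih := h.assocAlong_of_length_add_eq h4 (e :: t) (-1 :: l) y x (by simp) (by simp)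
      (by grind)
    have moved := h.mul_two_letters_mul h4 x y 1 d hl (t := e :: t) (by simp) (by grind)
    refine h.assocAlong_of_odd y x hl ht (by grind) odd_one ?_
    have split := ih.assoc d
    rw [altProd_cons y x (-1), Loop.mul_inv_rev, Loop.inv_zpow, neg_neg, moved] at split
    rw [altProd_cons x y d, split]

end LinksCompose

/-! ### Four letters and the induction -/

theorem zpow_mul_mul_zpow_of_even (x y : L) {a : ℤ} (ha : Even a) (b c d : ℤ) :
    x ^ a * (y ^ b * x ^ c) * y ^ d = x ^ a * (y ^ b * x ^ c * y ^ d) := by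
  obtain ⟨m, hm⟩ := ha
  have inv_eq : (y ^ b * x ^ c)⁻¹ = x ^ (-c) * y ^ (-b) := by simp
  have inv_mul : (y ^ b * x ^ c)⁻¹ * y ^ d = x ^ (-c) * y ^ (-b + d) := by simp
  have inv_left : (x ^ a * (y ^ b * x ^ c))⁻¹ = x ^ (-c) * y ^ (-b) * x ^ (-a) := by simp
  have diag (i : ℤ) : x ^ (-c) * y ^ (-b) * x ^ i * (x ^ (-i) * y ^ (-b + d)) =
      x ^ (-c) * y ^ (-b) * x ^ (0 : ℤ) * (x ^ (0 : ℤ) * y ^ (-b + d)) := by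
    have := (linksCompose_three (L := L)) y x [c] [i] [] (-b) (-b + d) (by simp)
    simpa [link, zpow_flexible] using this
  have slide := (isProgression_zpow_mul x (y ^ (-b + d))).mul_eq_mul_of_diag
    (f := fun i => x ^ (-c) * y ^ (-b) * x ^ i) diag 0 (-c) (-m)
  rw [show 0 + 2 * -m = -a by lia, show -c - 2 * -m = a + -c by lia, Loop.zpow_zero, mul_one,
    ← inv_left, ← inv_eq, ← zpow_mul_zpow_mul] at slide
  apply mul_mul_of_mul_inv_mul_inv_mul
  rw [inv_mul, slide, Loop.mul_inv_cancel_left]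

theorem zpow_mul_mul_zpow_mul_self (x y : L) (a c : ℤ) :
    x ^ a * y * (x ^ c * y) = x ^ a * (y * (x ^ c * y)) := by
  have mul_self_mul_self (z v : L) : z * v * v = z * v ^ (2 : ℤ) := by
    simpa using mul_zpow_mul_zpow z v 1 1
  have y_eq : y = x ^ (-c) * (x ^ c * y) := by simp
  calc
    x ^ a * y * (x ^ c * y) = x ^ (a - c) * (x ^ c * y) * (x ^ c * y) := by
      rw [zpow_mul_zpow_mul, sub_add_cancel]
    _ = x ^ a * (x ^ (-c) * (x ^ c * y) * (x ^ c * y)) := by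
      rw [mul_self_mul_self, mul_self_mul_self, zpow_mul_zpow_mul, sub_eq_add_neg]
    _ = x ^ a * (y * (x ^ c * y)) := by rw [← y_eq]

theorem zpow_mul_inv_mul_of_even (x y : L) (a c : ℤ) {d : ℤ} (hd : Even d) :
    x ^ a * y⁻¹ * (x ^ c * y ^ d) = x ^ a * (y⁻¹ * (x ^ c * y ^ d)) := by
  have outer : x ^ a * (y⁻¹ * x ^ c) * y ^ d = x ^ a * (y⁻¹ * (x ^ c * y ^ d)) := by
    have flip := zpow_mul_mul_zpow_of_even y x hd.neg (-c) 1 (-a)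
    have flex := zpow_flexible y (x ^ (-c)) (-d) 1
    simp only [Loop.zpow_one] at flip flex
    apply inv_injective
    simpa [flex] using flip.symm
  have base : x ^ a * y⁻¹ * x⁻¹ * y ^ d = x ^ a * y⁻¹ * (x⁻¹ * y ^ d) := by
    apply inv_injective
    simpa using ((linksCompose_three (L := L)).zpow_mul_mul_altProd_replicate y x (-d) (-a)
      (m := 1) (by simp)).symm
  have inner := ((linksCompose_three (L := L)).assocAlong_of_odd x y (r := [1, -a]) (t := [d])
    (by simp) (by simp) (by simp) odd_neg_one (by simpa using base)).assoc c
  simp only [altProd_cons, altProd_nil, mul_one, Loop.mul_inv_rev, Loop.inv_zpow, neg_neg,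
    Loop.zpow_neg_one] at inner
  rw [← inner, ← zpow_flexible, outer]

theorem assocAlong_zpow_zpow_mul_zpow (x y : L) (a c d : ℤ) :
    AssocAlong (x ^ a) y (x ^ c * y ^ d) := by
  have of_odd {e : ℤ} (he : Odd e)
      (assoc_e : x ^ a * y ^ e * (x ^ c * y ^ d) = x ^ a * (y ^ e * (x ^ c * y ^ d))) :
      AssocAlong (x ^ a) y (x ^ c * y ^ d) := by
    simpa using (linksCompose_three (L := L)).assocAlong_of_odd y x (r := [-a]) (t := [c, d])
      (by simp) (by simp) (by simp) he (by simpa using assoc_e)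
  rcases Int.even_or_odd d with hd | hd
  · exact of_odd odd_neg_one (by simpa using zpow_mul_inv_mul_of_even x y a c hd)
  · exact of_odd hd (zpow_mul_mul_zpow_mul_self x (y ^ d) a c)

theorem linksCompose_four : LinksCompose L 4 := by
  have one_two (x y : L) {r t : List ℤ} (hr : r.length = 1) (ht : t.length = 2) :
      AssocAlong (altProd y x r)⁻¹ x (altProd y x t) := by
    obtain ⟨a, rfl⟩ := List.length_eq_one_iff.1 hr
    obtain ⟨b, c, rfl⟩ := List.length_eq_two.1 ht
    simpa using assocAlong_zpow_zpow_mul_zpow y x (-a) b c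
  refine linksCompose_three.succ fun x y r t hr ht hn => ?_
  have := List.length_pos_iff.2 hr
  have := List.length_pos_iff.2 ht
  rcases (show r.length = 1 ∨ t.length = 1 by lia) with hr | ht
  · exact one_two x y hr (by lia)
  · simpa using (one_two x y ht (by lia)).symm

theorem linksCompose (n : ℕ) : LinksCompose L n := by
  induction n with
  | zero => exact fun _ _ _ _ _ _ _ h => by lia
  | succ n ih =>
    rcases Nat.lt_or_ge n 4 with hn | hn
    · intro x y r s t i j h
      exact linksCompose_four x y r s t i j (by lia)
    · exact ih.succ fun x y r t hr ht hl => ih.assocAlong_of_length_add_eq hn t r y x ht hr hl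

theorem inv_altProd_mul_altProd_trans (x y : L) (r s t : List ℤ) :
    (altProd x y r)⁻¹ * altProd x y s * ((altProd x y s)⁻¹ * altProd x y t) =
      (altProd x y r)⁻¹ * altProd x y t := by
  simpa [link] using linksCompose _ y x r s t 0 0 (Nat.lt_succ_self _)

theorem exists_altProd_eq_mul (x y : L) (p q : List ℤ) :
    ∃ l, altProd x y l = altProd x y p * altProd x y q := by
  induction p generalizing x y q with
  | nil => exact ⟨q, by simp⟩
  | cons a p ih =>
    obtain ⟨l, hl⟩ := ih y x (0 :: q)
    have cancel := (linksCompose (L := L) _).assocAlong x y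
      (Nat.lt_succ_self (p.length + l.length)) (-a) a
    rw [neg_add_cancel, Loop.zpow_zero, one_mul, hl, Loop.inv_mul_cancel_left] at cancel
    have inv_eq : (altProd y x p)⁻¹ * x ^ (-a) = (altProd x y (a :: p))⁻¹ := by simp
    refine ⟨a :: l, ?_⟩
    rw [← one_mul (altProd x y q), ← Loop.zpow_zero y, ← altProd_cons, ← cancel, inv_eq,
      Loop.mul_inv_cancel_left, altProd_cons, hl]

theorem exists_altProd_eq_inv (x y : L) (p : List ℤ) :
    ∃ l, altProd x y l = (altProd x y p)⁻¹ := by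
  induction p generalizing x y with
  | nil => exact ⟨[], by simp⟩
  | cons a p ih =>
    obtain ⟨q, hq⟩ := ih y x
    obtain ⟨l, hl⟩ := exists_altProd_eq_mul x y (0 :: q) [-a]
    exact ⟨l, by simpa [hq] using hl⟩

/-- The alternating products of powers of `x` and `y`, as a subloop. -/
def altProdSubloop (x y : L) : Subloop L where
  carrier := Set.range (altProd x y)
  one_mem := ⟨[], rfl⟩
  mul_mem := by
    rintro _ _ ⟨p, rfl⟩ ⟨q, rfl⟩
    exact exists_altProd_eq_mul x y p q
  ldiv_mem := by
    rintro _ _ ⟨p, rfl⟩ ⟨q, rfl⟩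
    obtain ⟨p', hp'⟩ := exists_altProd_eq_inv x y p
    rw [ldiv_eq_inv_mul, ← hp']
    exact exists_altProd_eq_mul x y p' q
  rdiv_mem := by
    rintro _ _ ⟨p, rfl⟩ ⟨q, rfl⟩
    obtain ⟨q', hq'⟩ := exists_altProd_eq_inv x y q
    rw [rdiv_eq_mul_inv, ← hq']
    exact exists_altProd_eq_mul x y p q'

theorem closure_pair_subset (x y : L) :
    (Subloop.closure ({x, y} : Set L)).carrier ⊆ Set.range (altProd x y) := by
  intro a ha
  refine ha (altProdSubloop x y) ?_
  rintro _ (rfl | rfl)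
  · exact ⟨[1], by simp⟩
  · exact ⟨[0, 1], by simp⟩

theorem altProd_mul_assoc (x y : L) (p q r : List ℤ) :
    altProd x y p * altProd x y q * altProd x y r =
      altProd x y p * (altProd x y q * altProd x y r) := by
  obtain ⟨p', hp'⟩ := exists_altProd_eq_inv x y p
  obtain ⟨l, hl⟩ := exists_altProd_eq_mul x y q r
  have hr : altProd x y r = (altProd x y q)⁻¹ * altProd x y l := by
    rw [hl, Loop.inv_mul_cancel_left]
  rw [← inv_inv (altProd x y p), ← hp', hr, inv_altProd_mul_altProd_trans,
    Loop.mul_inv_cancel_left]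

end AlternatingProducts

end Loop

theorem theorem1p4 {L : Type u} [Loop L] (hL : Loop.IsARIF L) :
    Loop.IsDiassociative L := by
  intro x y
  have : Fact (Loop.IsARIF L) := ⟨hL⟩
  refine Loop.isGroup_of_mul_assoc fun a b c => Subtype.ext ?_
  obtain ⟨p, hp⟩ := Loop.closure_pair_subset x y a.2
  obtain ⟨q, hq⟩ := Loop.closure_pair_subset x y b.2
  obtain ⟨r, hr⟩ := Loop.closure_pair_subset x y c.2
  change a.1 * b.1 * c.1 = a.1 * (b.1 * c.1)
  rw [← hp, ← hq, ← hr, Loop.altProd_mul_assoc]
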